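/- Let $M$ be a smooth manifold and let $E\to M$ be a smooth real vector bundle. Let $\mathfrak D E$ be the bundle of covariant differential operators of $E$: its sections are the $\mathbb R$-linear operators $\mathfrak d:\Gamma(E)\to\Gamma(E)$ such that $\mathfrak d(fu)=f\,\mathfrak d(u)+\mathbb j(\mathfrak d)(f)\,u$ for a vector field $\mathbb j(\mathfrak d)$, with the commutator bracket $[\cdot,\cdot]_{\mathfrak D}$. Let $\mathfrak J E\subset\mathrm{Hom}(\mathfrak D E,E)$ be the first jet bundle, where the jet $[u]_m$ acts by $\mathfrak d\mapsto\mathfrak d u$, and let $\mathbb d u\in\Gamma(\mathfrak J E)$ be the jet prolongation of $u\in\Gamma(E)$. *$E$-Courant algebroids.* An $E$-Courant algebroid is a vector bundle $\mathcal K\to M$ with a symmetric nondegenerate $E$-valued pairing $(\cdot,\cdot)_E$ on $\mathcal K$, an $\mathbb R$-bilinear bracket $[\cdot,\cdot]$ on $\Gamma(\mathcal K)$ satisfying the Leibniz identity $[X,[Y,Z]]=[[X,Y],Z]+[Y,[X,Z]]$, and a bundle map $\rho:\mathcal K\to\mathfrak D E$, such that, with $\rho^\star:\mathrm{Hom}(\mathfrak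 D E,E)\to\mathrm{Hom}(\mathcal K,E)$, $\rho^\star(\nu)(k)=\nu(\rho(k))$, and with $\mathcal K$ embedded in $\mathrm{Hom}(\mathcal K,E)$ by $k\mapsto 2(k,\cdot)_E$, for all $X,Y,Z\in\Gamma(\mathcal K)$: (EC-1) $\rho[X,Y]=[\rho(X),\rho(Y)]_{\mathfrak D}$; (EC-2) $[X,X]=\rho^\star\mathbb d(X,X)_E$; (EC-3) $\rho(X)(Y,Z)_E=([X,Y],Z)_E+(Y,[X,Z])_E$; (EC-4) $\rho^\star(\mathfrak J E)\subset\mathcal K$, i.e. $(\rho^\star(\mu),X)_E=\tfrac12\mu(\rho(X))$ for $\mu\in\mathfrak J E$; (EC-5) $\rho\circ\rho^\star=0$ on $\mathfrak J E$. *$E$-dual pairs.* Let $A$, $B$ be vector bundles over $M$ with a fibrewise nondegenerate $E$-valued pairing $\langle\cdot,\cdot\rangle_E:A\times_M B\to E$, so that $B\subset\mathrm{Hom}(A,E)$ and $A\subset\mathrm{Hom}(B,E)$. For a Lie algebroid structure on $A$ with a representation $\rho_A:A\to\mathfrak D E$, let $\mathrm d^A$ be the associated coboundary operator on $\Omega^\bullet(A,E)=\Gamma(\mathrm{Hom}(\wedge^\bullet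 A,E))$. Put $\mathrm{Hom}(\wedge^0A,E)_B=E$, and for $k\ge1$ let $\mathrm{Hom}(\wedge^kA,E)_B$ consist of those $\mu$ for which $\mu(X_1,\dots,X_{k-1},\cdot)\in B$ for all $X_i$ (so it is $B$ for $k=1$). The representation is called $B$-invariant if $\mathrm d^A$ maps $\Gamma(\mathrm{Hom}(\wedge^kA,E)_B)$ into $\Gamma(\mathrm{Hom}(\wedge^{k+1}A,E)_B)$ for all $k\ge0$. An $E$-dual pair of Lie algebroids $((A,\rho_A);(B,\rho_B))$ consists of Lie algebroid structures on such $A$ and $B$, a $B$-invariant representation $\rho_A$ of $A$ on $E$ and an $A$-invariant representation $\rho_B$ of $B$ on $E$. Then, for $u\in\Gamma(E)$, $X\in\Gamma(A)$, $\xi\in\Gamma(B)$, there are $\mathrm d^Au\in\Gamma(B)$ and $\mathfrak L_X\xi\in\Gamma(B)$ with $\langle Y,\mathrm d^Au\rangle_E=\rho_A(Y)u$ and $\langle Y,\mathfrak L_X\xi\rangle_E=\rho_A(X)\langle Y,\xi\rangle_E-\langle[X,Y],\xi\rangle_E$ for all $Y\in\Gamma(A)$; similarly $\mathrm d^Bu\in\Gamma(A)$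 and $\mathfrak L_\xi X\in\Gamma(A)$. Also $\mathfrak L_XY=[X,Y]$ for $Y\in\Gamma(A)$, and for $\Xi\in\Gamma(\mathrm{Hom}(\wedge^2B,E))$, $(\mathfrak L_X\Xi)(\xi,\eta)=\rho_A(X)(\Xi(\xi,\eta))-\Xi(\mathfrak L_X\xi,\eta)-\Xi(\xi,\mathfrak L_X\eta)$. *$E$-Lie bialgebroids.* The $E$-dual pair is an $E$-Lie bialgebroid $(A,B)$ if for all $X,Y\in\Gamma(A)$ and $u\in\Gamma(E)$: (1) $\mathrm d^B[X,Y]=\mathfrak L_X(\mathrm d^BY)-\mathfrak L_Y(\mathrm d^BX)$; (2) $\mathfrak L_{\mathrm d^Au}X=-\mathfrak L_{\mathrm d^Bu}X$; (3) $\langle\mathrm d^Bu,\mathrm d^Au\rangle_E=0$. **Theorem.** Let $(A,B)$ be an $E$-Lie bialgebroid. On $A\oplus B$ define, for $X_i\in\Gamma(A)$ and $\xi_i\in\Gamma(B)$, the pairing $$(X_1+\xi_1,X_2+\xi_2)_E=\tfrac12\big(\langle X_1,\xi_2\rangle_E+\langle X_2,\xi_1\rangle_E\big)$$ and the bracket $$[X_1+\xi_1,X_2+\xi_2]_{A\oplus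 B}=[X_1,X_2]+\mathfrak L_{\xi_1}X_2-\mathfrak L_{\xi_2}X_1+\mathrm d^B\langle X_1,\xi_2\rangle_E+[\xi_1,\xi_2]+\mathfrak L_{X_1}\xi_2-\mathfrak L_{X_2}\xi_1+\mathrm d^A\langle X_2,\xi_1\rangle_E.$$ Then $(A\oplus B,(\cdot,\cdot)_E,[\cdot,\cdot]_{A\oplus B},\rho_A+\rho_B)$ is an $E$-Courant algebroid. -/

import Mathlib

open scoped Manifold ContDiff
open Bundle

namespace ECourant

noncomputable section

section Bundles

variable {EM : Type*} [NormedAddCommGroup EM] [NormedSpace ℝ EM]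
  {H : Type*} [TopologicalSpace H] (I : ModelWithCorners ℝ EM H)
  {M : Type*} [TopologicalSpace M] [ChartedSpace H M] [IsManifold I ∞ M]
  (FE : Type*) [NormedAddCommGroup FE] [NormedSpace ℝ FE]
  (E : M → Type*) [TopologicalSpace (TotalSpace FE E)]
  [∀ m, AddCommGroup (E m)] [∀ m, Module ℝ (E m)] [∀ m, TopologicalSpace (E m)]
  [FiberBundle FE E] [VectorBundle ℝ FE E]
  (FA : Type*) [NormedAddCommGroup FA] [NormedSpace ℝ FA]
  (A : M → Type*) [TopologicalSpace (TotalSpace FA A)]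
  [∀ m, AddCommGroup (A m)] [∀ m, Module ℝ (A m)] [∀ m, TopologicalSpace (A m)]
  [FiberBundle FA A] [VectorBundle ℝ FA A]
  (FB : Type*) [NormedAddCommGroup FB] [NormedSpace ℝ FB]
  (B : M → Type*) [TopologicalSpace (TotalSpace FB B)]
  [∀ m, AddCommGroup (B m)] [∀ m, Module ℝ (B m)] [∀ m, TopologicalSpace (B m)]
  [FiberBundle FB B] [VectorBundle ℝ FB B]
  (FK : Type*) [NormedAddCommGroup FK] [NormedSpace ℝ FK]
  (K : M → Type*) [TopologicalSpace (TotalSpace FK K)]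
  [∀ m, AddCommGroup (K m)] [∀ m, Module ℝ (K m)] [∀ m, TopologicalSpace (K m)]
  [FiberBundle FK K] [VectorBundle ℝ FK K]

/-! ### The gauge bundle `𝔇E` and the jet bundle `𝔍E`

The smooth sections `Γ(V)` of a vector bundle `V` with model fibre `F` are `Cₛ^∞⟮I; F, V⟯`. -/

variable {I FE E} in
/-- The product `f u` of a smooth function and a smooth section. -/
def smulSec (f : C^∞⟮I, M; ℝ⟯) (u : Cₛ^∞⟮I; FE, E⟯) : Cₛ^∞⟮I; FE, E⟯ :=
  ⟨fun m => f m • u m, f.contMDiff.smul_section u.contMDiff⟩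

variable {I FE E} in
/-- `δ : Γ(E) → E_m` is a covariant differential operator at `m` with symbol `𝕛(δ) = v ∈ T_m M`:
`δ(f u) = f(m) δ(u) + v(f) u(m)`. -/
def HasSymbol {m : M} (δ : Cₛ^∞⟮I; FE, E⟯ →ₗ[ℝ] E m) (v : TangentSpace I m) : Prop :=
  ∀ (f : C^∞⟮I, M; ℝ⟯) (u : Cₛ^∞⟮I; FE, E⟯),
    δ (smulSec f u) = f m • δ u + (mvfderiv I f m v) • u m

/-- The fibre at `m` of the covariant differential operator bundle `𝔇E`. -/
def gaugeFiber (m : M) : Submodule ℝ (Cₛ^∞⟮I; FE, E⟯ →ₗ[ℝ] E m) where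
  carrier := {δ | ∃ v : TangentSpace I m, HasSymbol δ v}
  zero_mem' := ⟨0, fun f u => by simp⟩
  add_mem' := by
    rintro δ ε ⟨v, hv⟩ ⟨w, hw⟩
    refine ⟨v + w, fun f u => ?_⟩
    rw [LinearMap.add_apply, hv, hw, LinearMap.add_apply, map_add, add_smul, smul_add]
    abel
  smul_mem' := by
    rintro c δ ⟨v, hv⟩
    refine ⟨c • v, fun f u => ?_⟩
    rw [LinearMap.smul_apply, hv, LinearMap.smul_apply, map_smul, smul_add, smul_comm c (f m),
      smul_assoc]

/-- The jet at `m` of a section `u` of `E`, regarded as the element `𝔡 ↦ 𝔡 u` of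
`Hom((𝔇E)_m, E_m)`; as a function of `m` this is `𝕕u`. -/
def jet (m : M) : Cₛ^∞⟮I; FE, E⟯ →ₗ[ℝ] (gaugeFiber I FE E m →ₗ[ℝ] E m) :=
  (gaugeFiber I FE E m).subtype.flip

/-- The fibre at `m` of the first jet bundle `𝔍E ⊂ Hom(𝔇E, E)`: all jets `[u]_m`. -/
def jetFiber (m : M) : Submodule ℝ (gaugeFiber I FE E m →ₗ[ℝ] E m) :=
  LinearMap.range (jet I FE E m)

/-- Smooth bundle maps `ρ : K → 𝔇E` over the identity of `M`. -/
structure GaugeMap where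
  toFun : ∀ m, K m →ₗ[ℝ] gaugeFiber I FE E m
  smooth : ∀ (X : Cₛ^∞⟮I; FK, K⟯) (u : Cₛ^∞⟮I; FE, E⟯),
    ContMDiff I (I.prod 𝓘(ℝ, FE)) ∞
      (fun m => TotalSpace.mk' FE m ((toFun m (X m) : Cₛ^∞⟮I; FE, E⟯ →ₗ[ℝ] E m) u))

namespace GaugeMap

variable {I FE E FK K}

/-- The section `ρ(X) u` of `E`, for sections `X` of `K` and `u` of `E`. -/
def act (ρ : GaugeMap I FE E FK K) (X : Cₛ^∞⟮I; FK, K⟯) (u : Cₛ^∞⟮I; FE, E⟯) :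
    Cₛ^∞⟮I; FE, E⟯ :=
  ⟨fun m => (ρ.toFun m (X m) : Cₛ^∞⟮I; FE, E⟯ →ₗ[ℝ] E m) u, ρ.smooth X u⟩

/-- The `E`-adjoint `ρ^⋆ : Hom(𝔇E, E) → Hom(K, E)`, `ρ^⋆(ν)(k) = ν(ρ(k))`, on fibres. -/
def star (ρ : GaugeMap I FE E FK K) (m : M) :
    (gaugeFiber I FE E m →ₗ[ℝ] E m) →ₗ[ℝ] (K m →ₗ[ℝ] E m) :=
  LinearMap.lcomp ℝ (E m) (ρ.toFun m)

end GaugeMap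

/-! ### `E`-valued pairings -/

/-- Smooth `E`-valued bilinear pairings `A ×_M B → E`. -/
structure BundlePairing where
  toFun : ∀ m, A m →ₗ[ℝ] B m →ₗ[ℝ] E m
  smooth : ∀ (X : Cₛ^∞⟮I; FA, A⟯) (ξ : Cₛ^∞⟮I; FB, B⟯),
    ContMDiff I (I.prod 𝓘(ℝ, FE)) ∞ (fun m => TotalSpace.mk' FE m (toFun m (X m) (ξ m)))

namespace BundlePairing

variable {I FE E FA A FB B}

/-- The section `⟨X, ξ⟩_E` of `E`. -/
def sec (P : BundlePairing I FE E FA A FB B) (X : Cₛ^∞⟮I; FA, A⟯) (ξ : Cₛ^∞⟮I; FB, B⟯) :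
    Cₛ^∞⟮I; FE, E⟯ :=
  ⟨fun m => P.toFun m (X m) (ξ m), P.smooth X ξ⟩

/-- The same pairing with the two bundles exchanged. -/
def flip (P : BundlePairing I FE E FA A FB B) : BundlePairing I FE E FB B FA A :=
  ⟨fun m => (P.toFun m).flip, fun ξ X => P.smooth X ξ⟩

/-- Nondegeneracy in both arguments, on every fibre. -/
def Nondegenerate (P : BundlePairing I FE E FA A FB B) : Prop :=
  (∀ m (x : A m), (∀ b : B m, P.toFun m x b = 0) → x = 0) ∧
    ∀ m (b : B m), (∀ x : A m, P.toFun m x b = 0) → b = 0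

end BundlePairing

/-! ### `E`-Courant algebroids -/

variable {I FE E FK K} in
/-- The embedding `K → Hom(K, E)`, `k ↦ 2 (k, ·)_E`, induced by an `E`-valued pairing on `K`.
With this normalization `κ ∈ K` and `ν ∈ Hom(K, E)` are identified when
`(κ, x)_E = ½ ν(x)` for all `x`. -/
def pairingEmb (P : BundlePairing I FE E FK K FK K) (m : M) : K m →ₗ[ℝ] (K m →ₗ[ℝ] E m) :=
  (2 : ℝ) • P.toFun m

variable {I FE E FK K} in
/-- `(K, (·,·)_E, [·,·], ρ)` is an `E`-Courant algebroid. -/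
structure IsECourantAlgebroid (P : BundlePairing I FE E FK K FK K)
    (br : Cₛ^∞⟮I; FK, K⟯ → Cₛ^∞⟮I; FK, K⟯ → Cₛ^∞⟮I; FK, K⟯)
    (ρ : GaugeMap I FE E FK K) : Prop where
  /-- `(Γ(K), [·,·])` is a Leibniz algebra over `ℝ`. -/
  add_br : ∀ X Y Z, br (X + Y) Z = br X Z + br Y Z
  smul_br : ∀ (c : ℝ) X Y, br (c • X) Y = c • br X Y
  br_add : ∀ X Y Z, br X (Y + Z) = br X Y + br X Z
  br_smul : ∀ (c : ℝ) X Y, br X (c • Y) = c • br X Y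
  leibniz : ∀ X Y Z, br X (br Y Z) = br (br X Y) Z + br Y (br X Z)
  symm : ∀ m (x y : K m), P.toFun m x y = P.toFun m y x
  nondegenerate : P.Nondegenerate
  /-- `ρ[X,Y] = [ρ(X), ρ(Y)]_𝔇` (commutator of operators on `Γ(E)`). -/
  anchor_br : ∀ X Y (u : Cₛ^∞⟮I; FE, E⟯),
    ρ.act (br X Y) u = ρ.act X (ρ.act Y u) - ρ.act Y (ρ.act X u)
  /-- `[X,X] = ρ^⋆ 𝕕 (X,X)_E`. -/
  br_self : ∀ X m, pairingEmb P m (br X X m) = ρ.star m (jet I FE E m (P.sec X X))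
  /-- `ρ(X)(Y,Z)_E = ([X,Y],Z)_E + (Y,[X,Z])_E`. -/
  invariance : ∀ X Y Z, ρ.act X (P.sec Y Z) = P.sec (br X Y) Z + P.sec Y (br X Z)
  /-- `ρ^⋆(𝔍E) ⊂ K`. -/
  star_mem : ∀ m, ∀ μ ∈ jetFiber I FE E m, ∃ κ : K m, pairingEmb P m κ = ρ.star m μ
  /-- `ρ ∘ ρ^⋆ = 0` on `𝔍E`. -/
  anchor_star : ∀ m, ∀ μ ∈ jetFiber I FE E m, ∀ κ : K m, pairingEmb P m κ = ρ.star m μ →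
    ρ.toFun m κ = 0

/-! ### Lie algebroids, representations and the associated complex -/

/-- Lie algebroid structures `([·,·], a)` on the vector bundle `A`. -/
structure LieAlgebroid where
  bracket : Cₛ^∞⟮I; FA, A⟯ →ₗ[ℝ] Cₛ^∞⟮I; FA, A⟯ →ₗ[ℝ] Cₛ^∞⟮I; FA, A⟯
  bracket_self : ∀ X, bracket X X = 0
  jacobi : ∀ X Y Z, bracket X (bracket Y Z) = bracket (bracket X Y) Z + bracket Y (bracket X Z)
  anchor : ∀ m, A m →ₗ[ℝ] TangentSpace I m
  anchor_smooth : ∀ X : Cₛ^∞⟮I; FA, A⟯,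
    ContMDiff I (I.prod 𝓘(ℝ, EM)) ∞ (fun m => TotalSpace.mk' EM m (anchor m (X m)))
  leibniz : ∀ (X Y : Cₛ^∞⟮I; FA, A⟯) (f : C^∞⟮I, M; ℝ⟯) (m : M),
    bracket X (smulSec f Y) m =
      f m • bracket X Y m + (mvfderiv I f m (anchor m (X m))) • Y m

variable {I FA A} in
/-- Representations of the Lie algebroid `A` on `E`: bundle maps `A → 𝔇E` that are compatible with
the anchors (`𝕛 ∘ ρ = a`) and with the brackets. -/
structure Representation (L : LieAlgebroid I FA A) extends GaugeMap I FE E FA A where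
  symbol : ∀ m (x : A m),
    HasSymbol (toFun m x : Cₛ^∞⟮I; FE, E⟯ →ₗ[ℝ] E m) (L.anchor m x)
  map_bracket : ∀ (X Y : Cₛ^∞⟮I; FA, A⟯) (u : Cₛ^∞⟮I; FE, E⟯),
    toGaugeMap.act (L.bracket X Y) u =
      toGaugeMap.act X (toGaugeMap.act Y u) - toGaugeMap.act Y (toGaugeMap.act X u)

/-- `Ω^k(A, E) = Γ(Hom(⋀^k A, E))`. -/
structure EForm (k : ℕ) where
  toFun : ∀ m, A m [⋀^Fin k]→ₗ[ℝ] E m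
  smooth : ∀ X : Fin k → Cₛ^∞⟮I; FA, A⟯,
    ContMDiff I (I.prod 𝓘(ℝ, FE)) ∞ (fun m => TotalSpace.mk' FE m (toFun m (fun i => X i m)))

namespace EForm

variable {I FE E FA A FB B}

/-- The section `φ(X₁, …, X_k)` of `E`. -/
def eval {k : ℕ} (φ : EForm I FE E FA A k) (X : Fin k → Cₛ^∞⟮I; FA, A⟯) : Cₛ^∞⟮I; FE, E⟯ :=
  ⟨fun m => φ.toFun m (fun i => X i m), φ.smooth X⟩

/-- `φ ∈ Γ(Hom(⋀^k A, E)_B)`: no condition for `k = 0`; for `k = j + 1` the bundle map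
`φ_♮ : ⋀^j A → Hom(A, E)`, `φ_♮(X₁, …, X_j)(Y) = φ(X₁, …, X_j, Y)`, takes its values in `B`, that
is, it sends sections of `A` to sections of `B`. -/
def MemHom (P : BundlePairing I FE E FA A FB B) : ∀ {k : ℕ}, EForm I FE E FA A k → Prop
  | 0, _ => True
  | j + 1, φ => ∀ X : Fin j → Cₛ^∞⟮I; FA, A⟯, ∃ ξ : Cₛ^∞⟮I; FB, B⟯, ∀ Y : Cₛ^∞⟮I; FA, A⟯,
      φ.eval (Fin.snoc (α := fun _ => Cₛ^∞⟮I; FA, A⟯) X Y) = P.sec Y ξ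

/-- A section of `E` as an element of `Ω^0(A, E)`. -/
def ofSec (u : Cₛ^∞⟮I; FE, E⟯) : EForm I FE E FA A 0 :=
  ⟨fun m => AlternatingMap.constOfIsEmpty ℝ (A m) (Fin 0) (u m), fun _ => u.contMDiff⟩

/-- A section `ξ` of `B` as the element `⟨·, ξ⟩_E` of `Ω^1(A, E)`. -/
def ofDual (P : BundlePairing I FE E FA A FB B) (ξ : Cₛ^∞⟮I; FB, B⟯) : EForm I FE E FA A 1 :=
  ⟨fun m => AlternatingMap.ofSubsingleton ℝ (A m) (E m) (0 : Fin 1) ((P.toFun m).flip (ξ m)),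
    fun X => P.smooth (X 0) ξ⟩

end EForm

section Complex

variable {I FE E FA A FB B}

/-- The sum `∑_{i<j} (-1)^{i+j} φ([X_i, X_j], X_0, …, X̂_i, …, X̂_j, …, X_k)`. -/
def koszulBracketPart (L : LieAlgebroid I FA A) : ∀ {k : ℕ}, EForm I FE E FA A k →
    (Fin (k + 1) → Cₛ^∞⟮I; FA, A⟯) → Cₛ^∞⟮I; FE, E⟯
  | 0, _, _ => 0
  | k + 1, φ, X => ∑ j : Fin (k + 2), ∑ i : Fin (k + 1),
      if i.castSucc < j then
        (-1 : ℝ) ^ ((i : ℕ) + (j : ℕ)) •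
          φ.eval (Fin.cons (α := fun _ => Cₛ^∞⟮I; FA, A⟯) (L.bracket (X i.castSucc) (X j))
            (fun l => X (j.succAbove (i.succAbove l))))
      else 0

/-- The coboundary `d^A φ` associated with a representation, evaluated on `k + 1` sections. -/
def coboundary {L : LieAlgebroid I FA A} (ρ : Representation FE E L) {k : ℕ}
    (φ : EForm I FE E FA A k) (X : Fin (k + 1) → Cₛ^∞⟮I; FA, A⟯) : Cₛ^∞⟮I; FE, E⟯ :=
  (∑ i : Fin (k + 1), (-1 : ℝ) ^ (i : ℕ) •
      ρ.act (X i) (φ.eval (fun l => X (i.succAbove l)))) +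
    koszulBracketPart L φ X

/-- `B`-invariance of a representation of `A`: `d^A` maps `Γ(Hom(⋀^k A, E)_B)` to
`Γ(Hom(⋀^{k+1} A, E)_B)` for all `k`. -/
def IsInvariant (P : BundlePairing I FE E FA A FB B) {L : LieAlgebroid I FA A}
    (ρ : Representation FE E L) : Prop :=
  ∀ (k : ℕ) (φ : EForm I FE E FA A k), φ.MemHom P →
    ∃ η : EForm I FE E FA A (k + 1), η.MemHom P ∧ ∀ X, η.eval X = coboundary ρ φ X

/-- A Lie algebroid structure on `A` with a `B`-invariant representation on `E`, where `A` and `B`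
are paired by `P`. -/
structure InvariantRep (P : BundlePairing I FE E FA A FB B) where
  lie : LieAlgebroid I FA A
  rep : Representation FE E lie
  invariant : IsInvariant P rep

namespace InvariantRep

variable {P : BundlePairing I FE E FA A FB B}

theorem exists_d (S : InvariantRep P) (u : Cₛ^∞⟮I; FE, E⟯) :
    ∃ ξ : Cₛ^∞⟮I; FB, B⟯, ∀ Y, P.sec Y ξ = S.rep.act Y u := by
  obtain ⟨η, hη, h⟩ := S.invariant 0 (EForm.ofSec u) trivial
  obtain ⟨ξ, hξ⟩ := hη Fin.elim0
  refine ⟨ξ, fun Y => ?_⟩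
  rw [← hξ Y, h]
  simp [coboundary, koszulBracketPart]
  rfl

/-- `d^A u`, as a section of `B`: `⟨Y, d^A u⟩_E = ρ_A(Y) u`. -/
def d (S : InvariantRep P) (u : Cₛ^∞⟮I; FE, E⟯) : Cₛ^∞⟮I; FB, B⟯ :=
  (S.exists_d u).choose

theorem sec_d (S : InvariantRep P) (u : Cₛ^∞⟮I; FE, E⟯) (Y : Cₛ^∞⟮I; FA, A⟯) :
    P.sec Y (S.d u) = S.rep.act Y u :=
  (S.exists_d u).choose_spec Y

/-- `d^A ξ ∈ Γ(Hom(⋀² A, E))` for a section `ξ` of `B ⊂ Hom(A, E)`. -/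
def dDual (S : InvariantRep P) (ξ : Cₛ^∞⟮I; FB, B⟯) (X : Fin 2 → Cₛ^∞⟮I; FA, A⟯) :
    Cₛ^∞⟮I; FE, E⟯ :=
  coboundary S.rep (EForm.ofDual P ξ) X

theorem dDual_apply (S : InvariantRep P) (ξ : Cₛ^∞⟮I; FB, B⟯) (X Y : Cₛ^∞⟮I; FA, A⟯) :
    S.dDual ξ ![X, Y] = S.rep.act X (P.sec Y ξ) - S.rep.act Y (P.sec X ξ) -
      P.sec (S.lie.bracket X Y) ξ := by
  have h1 : S.dDual ξ ![X, Y] = ((-1 : ℝ) ^ 0 • S.rep.act X (P.sec Y ξ) +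
      (-1 : ℝ) ^ 1 • S.rep.act Y (P.sec X ξ)) +
        koszulBracketPart S.lie (EForm.ofDual P ξ) ![X, Y] := by
    rw [dDual, coboundary, Fin.sum_univ_two]
    rfl
  have h2 : ∀ Z : Cₛ^∞⟮I; FA, A⟯, ∀ f : Fin 0 → Cₛ^∞⟮I; FA, A⟯,
      (EForm.ofDual P ξ).eval (Fin.cons (α := fun _ => Cₛ^∞⟮I; FA, A⟯) Z f) = P.sec Z ξ :=
    fun _ _ => rfl
  have h3 : koszulBracketPart S.lie (EForm.ofDual P ξ) ![X, Y] =
      -P.sec (S.lie.bracket X Y) ξ := by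
    simp [koszulBracketPart, h2]
  rw [h1, h3, pow_zero, pow_one, one_smul, neg_one_smul, sub_eq_add_neg, sub_eq_add_neg]

theorem exists_lieDer (S : InvariantRep P) (X : Cₛ^∞⟮I; FA, A⟯) (ξ : Cₛ^∞⟮I; FB, B⟯) :
    ∃ ζ : Cₛ^∞⟮I; FB, B⟯, ∀ Y,
      P.sec Y ζ = S.rep.act X (P.sec Y ξ) - P.sec (S.lie.bracket X Y) ξ := by
  obtain ⟨η, hη, h⟩ := S.invariant 1 (EForm.ofDual P ξ) (fun _ => ⟨ξ, fun _ => rfl⟩)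
  obtain ⟨ζ, hζ⟩ := hη ![X]
  obtain ⟨θ, hθ⟩ := S.exists_d (P.sec X ξ)
  refine ⟨ζ + θ, fun Y => ?_⟩
  have hs : (Fin.snoc (α := fun _ => Cₛ^∞⟮I; FA, A⟯) ![X] Y : Fin 2 → Cₛ^∞⟮I; FA, A⟯) = ![X, Y] := by
    funext i
    fin_cases i <;> rfl
  have h1 : P.sec Y (ζ + θ) = P.sec Y ζ + P.sec Y θ := by
    ext m
    exact map_add (P.toFun m (Y m)) (ζ m) (θ m)
  have h2 := S.dDual_apply ξ X Y
  rw [dDual, ← h, ← hs, hζ Y] at h2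
  rw [h1, hθ, h2]
  abel

/-- The Lie derivative `𝔏_X ξ`, as a section of `B`:
`⟨Y, 𝔏_X ξ⟩_E = ρ_A(X)⟨Y, ξ⟩_E - ⟨[X, Y], ξ⟩_E`. -/
def lieDer (S : InvariantRep P) (X : Cₛ^∞⟮I; FA, A⟯) (ξ : Cₛ^∞⟮I; FB, B⟯) : Cₛ^∞⟮I; FB, B⟯ :=
  (S.exists_lieDer X ξ).choose

theorem sec_lieDer (S : InvariantRep P) (X : Cₛ^∞⟮I; FA, A⟯) (ξ : Cₛ^∞⟮I; FB, B⟯)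
    (Y : Cₛ^∞⟮I; FA, A⟯) :
    P.sec Y (S.lieDer X ξ) = S.rep.act X (P.sec Y ξ) - P.sec (S.lie.bracket X Y) ξ :=
  (S.exists_lieDer X ξ).choose_spec Y

/-- The Lie derivative `𝔏_X Ξ` for `Ξ ∈ Γ(Hom(⋀^k B, E))`, both regarded as functions of `k`
sections of `B`. -/
def lieDerForm (S : InvariantRep P) (X : Cₛ^∞⟮I; FA, A⟯) {k : ℕ}
    (Ξ : (Fin k → Cₛ^∞⟮I; FB, B⟯) → Cₛ^∞⟮I; FE, E⟯) (η : Fin k → Cₛ^∞⟮I; FB, B⟯) :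
    Cₛ^∞⟮I; FE, E⟯ :=
  S.rep.act X (Ξ η) - ∑ i, Ξ (Function.update η i (S.lieDer X (η i)))

end InvariantRep

end Complex

/-! ### `E`-dual pairs of Lie algebroids and `E`-Lie bialgebroids -/

/-- `E`-dual pairs of Lie algebroids `((A, ρ_A); (B, ρ_B))`. The nondegenerate pairing identifies
`B` with a subbundle of `Hom(A, E)` and `A` with a subbundle of `Hom(B, E)`. -/
structure EDualPair where
  pairing : BundlePairing I FE E FA A FB B
  nondegenerate : pairing.Nondegenerate
  left : InvariantRep pairing
  right : InvariantRep pairing.flip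

variable {I FE E FA A FB B}

/-- The three compatibility conditions of an `E`-Lie bialgebroid. -/
structure EDualPair.IsELieBialgebroid (D : EDualPair I FE E FA A FB B) : Prop where
  /-- `d^B[X,Y] = 𝔏_X(d^B Y) - 𝔏_Y(d^B X)`. -/
  d_bracket : ∀ X Y : Cₛ^∞⟮I; FA, A⟯,
    D.right.dDual (D.left.lie.bracket X Y) =
      D.left.lieDerForm X (D.right.dDual Y) - D.left.lieDerForm Y (D.right.dDual X)
  /-- `𝔏_{d^A u} X = - 𝔏_{d^B u} X`. -/
  lieDer_d : ∀ (u : Cₛ^∞⟮I; FE, E⟯) (X : Cₛ^∞⟮I; FA, A⟯),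
    D.right.lieDer (D.left.d u) X = -D.left.lie.bracket (D.right.d u) X
  /-- `⟨d^B u, d^A u⟩_E = 0`. -/
  pairing_d : ∀ u : Cₛ^∞⟮I; FE, E⟯, D.pairing.sec (D.right.d u) (D.left.d u) = 0

/-! ### The double `A ⊕ B` -/

/-- The section `X + ξ` of `A ⊕ B`. -/
def prodSec (X : Cₛ^∞⟮I; FA, A⟯) (ξ : Cₛ^∞⟮I; FB, B⟯) : Cₛ^∞⟮I; FA × FB, A ×ᵇ B⟯ :=
  ⟨fun m => (X m, ξ m), fun m => by
    rw [contMDiffAt_section]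
    exact ((contMDiffAt_section m).1 (X.contMDiff m)).prodMk_space
      ((contMDiffAt_section m).1 (ξ.contMDiff m))⟩

/-- The `A`-component of a section of `A ⊕ B`. -/
def fstSec (e : Cₛ^∞⟮I; FA × FB, A ×ᵇ B⟯) : Cₛ^∞⟮I; FA, A⟯ :=
  ⟨fun m => (e m).1, fun m => by
    rw [contMDiffAt_section]
    exact ((ContinuousLinearMap.fst ℝ FA FB).contMDiff.contMDiffAt (n := ∞)).comp m
      ((contMDiffAt_section m).1 (e.contMDiff m))⟩

/-- The `B`-component of a section of `A ⊕ B`. -/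
def sndSec (e : Cₛ^∞⟮I; FA × FB, A ×ᵇ B⟯) : Cₛ^∞⟮I; FB, B⟯ :=
  ⟨fun m => (e m).2, fun m => by
    rw [contMDiffAt_section]
    exact ((ContinuousLinearMap.snd ℝ FA FB).contMDiff.contMDiffAt (n := ∞)).comp m
      ((contMDiffAt_section m).1 (e.contMDiff m))⟩

namespace EDualPair

/-- `(X₁ + ξ₁, X₂ + ξ₂)_E = ½ (⟨X₁, ξ₂⟩_E + ⟨X₂, ξ₁⟩_E)`. -/
def doublePairing (D : EDualPair I FE E FA A FB B) :
    BundlePairing I FE E (FA × FB) (A ×ᵇ B) (FA × FB) (A ×ᵇ B) where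
  toFun m := LinearMap.mk₂ ℝ
    (fun (x y : A m × B m) =>
      (1 / 2 : ℝ) • (D.pairing.toFun m x.1 y.2 + D.pairing.toFun m y.1 x.2))
    (fun x x' y => by simp; abel)
    (fun c x y => by simp; rw [smul_comm c, smul_comm c])
    (fun x y y' => by simp; abel)
    (fun c x y => by simp; rw [smul_comm c, smul_comm c])
  smooth e e' := ((1 / 2 : ℝ) • (D.pairing.sec (fstSec e) (sndSec e') +
    D.pairing.sec (fstSec e') (sndSec e))).contMDiff

/-- `[X₁ + ξ₁, X₂ + ξ₂] = [X₁, X₂] + 𝔏_{ξ₁} X₂ - 𝔏_{ξ₂} X₁ + d^B⟨X₁, ξ₂⟩_E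
  + [ξ₁, ξ₂] + 𝔏_{X₁} ξ₂ - 𝔏_{X₂} ξ₁ + d^A⟨X₂, ξ₁⟩_E`. -/
def doubleBracket (D : EDualPair I FE E FA A FB B)
    (e₁ e₂ : Cₛ^∞⟮I; FA × FB, A ×ᵇ B⟯) : Cₛ^∞⟮I; FA × FB, A ×ᵇ B⟯ :=
  prodSec
    (D.left.lie.bracket (fstSec e₁) (fstSec e₂) + D.right.lieDer (sndSec e₁) (fstSec e₂) -
      D.right.lieDer (sndSec e₂) (fstSec e₁) +
      D.right.d (D.pairing.sec (fstSec e₁) (sndSec e₂)))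
    (D.right.lie.bracket (sndSec e₁) (sndSec e₂) + D.left.lieDer (fstSec e₁) (sndSec e₂) -
      D.left.lieDer (fstSec e₂) (sndSec e₁) +
      D.left.d (D.pairing.sec (fstSec e₂) (sndSec e₁)))

/-- `ρ_A + ρ_B : A ⊕ B → 𝔇E`. -/
def doubleAnchor (D : EDualPair I FE E FA A FB B) : GaugeMap I FE E (FA × FB) (A ×ᵇ B) where
  toFun m := (D.left.rep.toFun m).coprod (D.right.rep.toFun m)
  smooth e u := (D.left.rep.act (fstSec e) u + D.right.rep.act (sndSec e) u).contMDiff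

end EDualPair

end Bundles

end

end ECourant

/-! Put 𝒟u = d^B u + d^A u. It represents ρ^⋆𝕕u in A ⊕ B, because 2(e, 𝒟u)_E = ρ(e)u. Hence [e,e] =
𝒟(e,e)_E, and invariance of the pairing follows from the definitions of d and 𝔏; both hold for every
E-dual pair.

Conditions (2) and (3) of a bialgebroid give three further facts: ρ(𝒟u) = 0 (`right_act_left_d`), ρ
preserves brackets (`doubleAnchor_bracket`), and [𝒟u, e] = 0 (`doubleBracket_doubleD`).

The Leibniz identity then needs no expansion over all arguments. These facts alone make (J(x,y,z),
w)_E totally skew-symmetric in x, y, z, w, where J is the Jacobiator (`jacobiator_swap_left`,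
`jacobiator_swap_right`, `pairing_jacobiator_swap`). With at least three arguments in A, or at least
three in B, it vanishes by the Jacobi identity of A or of B. With two of each it is half of
condition (1) evaluated on two sections of B (`sec_jacobiator`). The assembly is
`jacobiator_eq_zero`.

Operators such as d and 𝔏 are determined by their pairings with smooth sections. Since every vector
extends to a global section, fibrewise nondegeneracy makes identities testable in this way. -/

namespace ECourant

set_option linter.unusedSectionVars false

/-! ### Skew-symmetry of the Jacobiator, in abstract form -/

section Leibniz

variable {V K : Type*} [AddCommGroup V] [Module ℝ V] [AddCommGroup K] [Module ℝ K]

/-- The Jacobiator of a bilinear bracket, measuring the failure of the Leibniz identity. -/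
def jacobiator (br : K →ₗ[ℝ] K →ₗ[ℝ] K) (x y z : K) : K :=
  br x (br y z) - br (br x y) z - br y (br x z)

variable {pr : K →ₗ[ℝ] K →ₗ[ℝ] V} {br : K →ₗ[ℝ] K →ₗ[ℝ] K} {act : K →ₗ[ℝ] V →ₗ[ℝ] V}
  {D : V →ₗ[ℝ] K}

theorem bracket_add_swap (hsymm : ∀ x y, pr x y = pr y x) (hself : ∀ x, br x x = D (pr x x))
    (x y : K) : br x y + br y x = (2 : ℝ) • D (pr x y) := by
  have h := hself (x + y)
  simp only [map_add, LinearMap.add_apply, hself, hsymm y x] at h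
  rw [two_smul]
  linear_combination (norm := module) h

/-- Only the middle term has a part symmetric in `x`, `y`. That part is a bracket with left entry `2
D(x, y)`, which acts as zero. -/
theorem jacobiator_swap_left (hsymm : ∀ x y, pr x y = pr y x)
    (hself : ∀ x, br x x = D (pr x x)) (hD0 : ∀ u x, br (D u) x = 0) (x y z : K) :
    jacobiator br x y z = -jacobiator br y x z := by
  have h : br (br x y) z + br (br y x) z = 0 := by
    rw [← LinearMap.add_apply, ← map_add, bracket_add_swap hsymm hself, map_smul,
      LinearMap.smul_apply, hD0, smul_zero]
  unfold jacobiator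
  linear_combination (norm := module) -h

/-- Since `[D u, x] = 0`, polarization gives `[x, D u] = D (act x u)`. The part symmetric in `y`,
`z` is therefore `D` applied to the invariance identity for `(y, z)`. -/
theorem jacobiator_swap_right (hsymm : ∀ x y, pr x y = pr y x)
    (hself : ∀ x, br x x = D (pr x x)) (hD0 : ∀ u x, br (D u) x = 0)
    (hinv : ∀ x y z, act x (pr y z) = pr (br x y) z + pr y (br x z))
    (hD : ∀ u x, (2 : ℝ) • pr x (D u) = act x u) (x y z : K) :
    jacobiator br x y z = -jacobiator br x z y := by
  have hxD : ∀ u, br x (D u) = D (act x u) := by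
    intro u
    have h := bracket_add_swap hsymm hself x (D u)
    rwa [hD0, add_zero, ← map_smul, hD] at h
  have h1 : br x (br y z) + br x (br z y) = (2 : ℝ) • D (act x (pr y z)) := by
    rw [← map_add, bracket_add_swap hsymm hself, map_smul, hxD]
  have h2 := bracket_add_swap hsymm hself (br x y) z
  have h3 := bracket_add_swap hsymm hself (br x z) y
  rw [hinv, map_add, hsymm y] at h1
  unfold jacobiator
  linear_combination (norm := module) h1 - h2 - h3

/-- Both sides of "the anchor preserves brackets" are applied to `(z, w)` and expanded by
invariance. The mixed terms cancel. -/
theorem pairing_jacobiator_swap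
    (hinv : ∀ x y z, act x (pr y z) = pr (br x y) z + pr y (br x z))
    (hact : ∀ x y u, act (br x y) u = act x (act y u) - act y (act x u)) (x y z w : K) :
    pr (jacobiator br x y z) w = -pr z (jacobiator br x y w) := by
  have h := hact x y (pr z w)
  simp only [hinv, map_add] at h
  simp only [jacobiator, map_sub, LinearMap.sub_apply]
  linear_combination (norm := module) -h

/-- A bracket with totally skew-symmetric Jacobiator satisfies the Leibniz identity as soon as the
Jacobiator vanishes on enough arguments from two complementary families. -/
theorem jacobiator_eq_zero {A B : Type*} (i : A → K) (j : B → K)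
    (hij : ∀ x, ∃ a b, x = i a + j b)
    (hpr : ∀ x, (∀ y, pr x y = 0) → x = 0)
    (hsymm : ∀ x y, pr x y = pr y x)
    (hself : ∀ x, br x x = D (pr x x)) (hD0 : ∀ u x, br (D u) x = 0)
    (hinv : ∀ x y z, act x (pr y z) = pr (br x y) z + pr y (br x z))
    (hD : ∀ u x, (2 : ℝ) • pr x (D u) = act x u)
    (hact : ∀ x y u, act (br x y) u = act x (act y u) - act y (act x u))
    (hA : ∀ a b c, jacobiator br (i a) (i b) (i c) = 0)
    (hB : ∀ a b c, jacobiator br (j a) (j b) (j c) = 0)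
    (hAB : ∀ a b c d, pr (jacobiator br (i a) (i b) (j c)) (j d) = 0) (x y z : K) :
    jacobiator br x y z = 0 := by
  have s1 := jacobiator_swap_left hsymm hself hD0
  have s2 := jacobiator_swap_right hsymm hself hD0 hinv hD
  have s3 : ∀ x y z w, pr (jacobiator br x y z) w = -pr (jacobiator br x y w) z := by
    intro x y z w
    rw [pairing_jacobiator_swap hinv hact, hsymm]
  have hA' : ∀ a b c w, pr (jacobiator br (i a) (i b) w) (i c) = 0 := by
    intro a b c w
    rw [s3, hA, map_zero, LinearMap.zero_apply, neg_zero]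
  have hB' : ∀ a b c w, pr (jacobiator br (j a) (j b) w) (j c) = 0 := by
    intro a b c w
    rw [s3, hB, map_zero, LinearMap.zero_apply, neg_zero]
  -- By skew-symmetry in four arguments, only the number of entries from each family matters: three
  -- or more from one family reduce to `hA` or `hB`, and two of each to `hAB`.
  have a1 : ∀ a b c, jacobiator br (i a) (i b) (j c) = 0 := by
    intro a b c
    refine hpr _ fun y => ?_
    obtain ⟨a', b', rfl⟩ := hij y
    rw [map_add, hA', hAB, add_zero]
  have a2 : ∀ a b c, jacobiator br (i a) (j b) (i c) = 0 := by
    intro a b c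
    rw [s2, a1, neg_zero]
  have a3 : ∀ a b c, jacobiator br (j a) (i b) (i c) = 0 := by
    intro a b c
    rw [s1, a2, neg_zero]
  have b1 : ∀ a b c, jacobiator br (j a) (j b) (i c) = 0 := by
    intro a b c
    refine hpr _ fun y => ?_
    obtain ⟨a', b', rfl⟩ := hij y
    -- Exchanging the last slot with the paired vector turns this two-and-two term into one already
    -- covered by `a3`.
    rw [map_add, hB', add_zero, s2, map_neg, LinearMap.neg_apply, s3, a3, map_zero,
      LinearMap.zero_apply, neg_zero, neg_zero]
  have b2 : ∀ a b c, jacobiator br (j a) (i b) (j c) = 0 := by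
    intro a b c
    rw [s2, b1, neg_zero]
  have b3 : ∀ a b c, jacobiator br (i a) (j b) (j c) = 0 := by
    intro a b c
    rw [s1, b2, neg_zero]
  have add1 : ∀ x x' y z, jacobiator br (x + x') y z = jacobiator br x y z + jacobiator br x' y z := by
    intro x x' y z
    simp only [jacobiator, map_add, LinearMap.add_apply]
    abel
  have add2 : ∀ x y y' z, jacobiator br x (y + y') z = jacobiator br x y z + jacobiator br x y' z := by
    intro x x' y z
    simp only [jacobiator, map_add, LinearMap.add_apply]
    abel
  have add3 : ∀ x y z z', jacobiator br x y (z + z') = jacobiator br x y z + jacobiator br x y z' := by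
    intro x x' y z
    simp only [jacobiator, map_add]
    abel
  obtain ⟨a, a', rfl⟩ := hij x
  obtain ⟨b, b', rfl⟩ := hij y
  obtain ⟨c, c', rfl⟩ := hij z
  simp only [add1, add2, add3, hA, hB, a1, a2, a3, b1, b2, b3, add_zero]

end Leibniz

/-! ### Extension of vectors to global sections -/

section Extension

open Filter Topology in
/-- Every vector of a smooth vector bundle extends to a global smooth section. -/
theorem exists_section_eq {EM : Type*} [NormedAddCommGroup EM] [NormedSpace ℝ EM]
    [FiniteDimensional ℝ EM] {H : Type*} [TopologicalSpace H] (I : ModelWithCorners ℝ EM H)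
    {M : Type*} [TopologicalSpace M] [ChartedSpace H M] [IsManifold I ∞ M]
    [T2Space M] [SigmaCompactSpace M]
    (F : Type*) [NormedAddCommGroup F] [NormedSpace ℝ F]
    (V : M → Type*) [TopologicalSpace (TotalSpace F V)]
    [∀ m, AddCommGroup (V m)] [∀ m, Module ℝ (V m)] [∀ m, TopologicalSpace (V m)]
    [FiberBundle F V] [VectorBundle ℝ F V] [ContMDiffVectorBundle ∞ F V I] (m : M) (v : V m) :
    ∃ s : Cₛ^∞⟮I; F, V⟯, s m = v := by
  -- The constraint is empty away from `m` and a single point at `m`, hence convex everywhere. A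
  -- partition of unity glues a local extension near `m` with the zero section off `m`.
  have hconv : ∀ y, Convex ℝ {w : V y | y = m → w = FiberBundle.extend F v y} := by
    intro y a ha b hb p q _ _ hpq hy
    rw [ha hy, hb hy, ← add_smul, hpq, one_smul]
  obtain ⟨s, hs⟩ := exists_contMDiffSection_forall_mem_convex_of_local (n := ⊤) (F_fiber := F) I V
    (fun y => {w | y = m → w = FiberBundle.extend F v y}) hconv fun x => by
      by_cases hx : x = m
      · subst hx
        obtain ⟨U, hU, h⟩ := FiberBundle.exists_contMDiffOn_extend (k := ∞) I F v
        exact ⟨U, hU, _, h, fun _ _ _ => rfl⟩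
      · exact ⟨{m}ᶜ, isOpen_compl_singleton.mem_nhds hx, fun _ => 0,
          (contMDiff_zeroSection ℝ V).contMDiffOn, fun y hy h => (hy h).elim⟩
  exact ⟨s, (hs m rfl).trans (by simp)⟩

end Extension

/-! ### Calculus of sections: bilinearity, separation, d and 𝔏 -/

noncomputable section Sections

variable {EM : Type*} [NormedAddCommGroup EM] [NormedSpace ℝ EM]
  {H : Type*} [TopologicalSpace H] {I : ModelWithCorners ℝ EM H}
  {M : Type*} [TopologicalSpace M] [ChartedSpace H M] [IsManifold I ∞ M]
  {FE : Type*} [NormedAddCommGroup FE] [NormedSpace ℝ FE]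
  {E : M → Type*} [TopologicalSpace (TotalSpace FE E)]
  [∀ m, AddCommGroup (E m)] [∀ m, Module ℝ (E m)] [∀ m, TopologicalSpace (E m)]
  [FiberBundle FE E] [VectorBundle ℝ FE E]
  {FA : Type*} [NormedAddCommGroup FA] [NormedSpace ℝ FA]
  {A : M → Type*} [TopologicalSpace (TotalSpace FA A)]
  [∀ m, AddCommGroup (A m)] [∀ m, Module ℝ (A m)] [∀ m, TopologicalSpace (A m)]
  [FiberBundle FA A] [VectorBundle ℝ FA A]
  {FB : Type*} [NormedAddCommGroup FB] [NormedSpace ℝ FB]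
  {B : M → Type*} [TopologicalSpace (TotalSpace FB B)]
  [∀ m, AddCommGroup (B m)] [∀ m, Module ℝ (B m)] [∀ m, TopologicalSpace (B m)]
  [FiberBundle FB B] [VectorBundle ℝ FB B]

namespace GaugeMap

variable (ρ : GaugeMap I FE E FA A)

@[simp] theorem act_add_left (X Y : Cₛ^∞⟮I; FA, A⟯) (u : Cₛ^∞⟮I; FE, E⟯) :
    ρ.act (X + Y) u = ρ.act X u + ρ.act Y u := by
  ext m; simp [act]

@[simp] theorem act_add_right (X : Cₛ^∞⟮I; FA, A⟯) (u v : Cₛ^∞⟮I; FE, E⟯) :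
    ρ.act X (u + v) = ρ.act X u + ρ.act X v := by
  ext m; simp [act]

@[simp] theorem act_sub_left (X Y : Cₛ^∞⟮I; FA, A⟯) (u : Cₛ^∞⟮I; FE, E⟯) :
    ρ.act (X - Y) u = ρ.act X u - ρ.act Y u := by
  ext m; simp [act]

@[simp] theorem act_sub_right (X : Cₛ^∞⟮I; FA, A⟯) (u v : Cₛ^∞⟮I; FE, E⟯) :
    ρ.act X (u - v) = ρ.act X u - ρ.act X v := by
  ext m; simp [act]

@[simp] theorem act_smul_left (c : ℝ) (X : Cₛ^∞⟮I; FA, A⟯) (u : Cₛ^∞⟮I; FE, E⟯) :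
    ρ.act (c • X) u = c • ρ.act X u := by
  ext m; simp [act]

@[simp] theorem act_smul_right (c : ℝ) (X : Cₛ^∞⟮I; FA, A⟯) (u : Cₛ^∞⟮I; FE, E⟯) :
    ρ.act X (c • u) = c • ρ.act X u := by
  ext m; simp [act]

@[simp] theorem act_zero_left (u : Cₛ^∞⟮I; FE, E⟯) :
    ρ.act 0 u = 0 := by
  ext m; simp [act]

@[simp] theorem act_zero_right (X : Cₛ^∞⟮I; FA, A⟯) :
    ρ.act X 0 = 0 := by
  ext m; simp [act]

/-- The action of sections of `A` on sections of `E`, as a bilinear map. -/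
def actₗ : Cₛ^∞⟮I; FA, A⟯ →ₗ[ℝ] Cₛ^∞⟮I; FE, E⟯ →ₗ[ℝ] Cₛ^∞⟮I; FE, E⟯ :=
  LinearMap.mk₂ ℝ ρ.act ρ.act_add_left ρ.act_smul_left ρ.act_add_right ρ.act_smul_right

end GaugeMap

namespace BundlePairing

variable (P : BundlePairing I FE E FA A FB B)

@[simp] theorem sec_add_left (X Y : Cₛ^∞⟮I; FA, A⟯) (ξ : Cₛ^∞⟮I; FB, B⟯) :
    P.sec (X + Y) ξ = P.sec X ξ + P.sec Y ξ := by
  ext m; simp [sec]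

@[simp] theorem sec_add_right (X : Cₛ^∞⟮I; FA, A⟯) (ξ η : Cₛ^∞⟮I; FB, B⟯) :
    P.sec X (ξ + η) = P.sec X ξ + P.sec X η := by
  ext m; simp [sec]

@[simp] theorem sec_sub_left (X Y : Cₛ^∞⟮I; FA, A⟯) (ξ : Cₛ^∞⟮I; FB, B⟯) :
    P.sec (X - Y) ξ = P.sec X ξ - P.sec Y ξ := by
  ext m; simp [sec]

@[simp] theorem sec_sub_right (X : Cₛ^∞⟮I; FA, A⟯) (ξ η : Cₛ^∞⟮I; FB, B⟯) :
    P.sec X (ξ - η) = P.sec X ξ - P.sec X η := by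
  ext m; simp [sec]

@[simp] theorem sec_neg_left (X : Cₛ^∞⟮I; FA, A⟯) (ξ : Cₛ^∞⟮I; FB, B⟯) :
    P.sec (-X) ξ = -P.sec X ξ := by
  ext m; simp [sec]

@[simp] theorem sec_neg_right (X : Cₛ^∞⟮I; FA, A⟯) (ξ : Cₛ^∞⟮I; FB, B⟯) :
    P.sec X (-ξ) = -P.sec X ξ := by
  ext m; simp [sec]

@[simp] theorem sec_smul_left (c : ℝ) (X : Cₛ^∞⟮I; FA, A⟯) (ξ : Cₛ^∞⟮I; FB, B⟯) :
    P.sec (c • X) ξ = c • P.sec X ξ := by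
  ext m; simp [sec]

@[simp] theorem sec_smul_right (c : ℝ) (X : Cₛ^∞⟮I; FA, A⟯) (ξ : Cₛ^∞⟮I; FB, B⟯) :
    P.sec X (c • ξ) = c • P.sec X ξ := by
  ext m; simp [sec]

@[simp] theorem sec_zero_left (ξ : Cₛ^∞⟮I; FB, B⟯) :
    P.sec 0 ξ = 0 := by
  ext m; simp [sec]

@[simp] theorem sec_zero_right (X : Cₛ^∞⟮I; FA, A⟯) :
    P.sec X 0 = 0 := by
  ext m; simp [sec]

/-- The pairing of sections of `A` and `B`, as a bilinear map. -/
def secₗ : Cₛ^∞⟮I; FA, A⟯ →ₗ[ℝ] Cₛ^∞⟮I; FB, B⟯ →ₗ[ℝ] Cₛ^∞⟮I; FE, E⟯ :=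
  LinearMap.mk₂ ℝ P.sec P.sec_add_left P.sec_smul_left P.sec_add_right P.sec_smul_right

theorem flip_sec (X : Cₛ^∞⟮I; FA, A⟯) (ξ : Cₛ^∞⟮I; FB, B⟯) : P.flip.sec ξ X = P.sec X ξ := rfl

/-- A section of `B` that pairs to zero with all sections of `A` vanishes. -/
def SeparatesRight : Prop := ∀ ξ, (∀ Y, P.sec Y ξ = 0) → ξ = 0

variable {P}

theorem SeparatesRight.ext (hP : P.SeparatesRight) {ξ η : Cₛ^∞⟮I; FB, B⟯}
    (h : ∀ Y, P.sec Y ξ = P.sec Y η) : ξ = η := by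
  refine sub_eq_zero.1 (hP _ fun Y => ?_)
  rw [P.sec_sub_right, h, sub_self]

theorem separatesRight_of_nondegenerate [FiniteDimensional ℝ EM] [T2Space M] [SigmaCompactSpace M]
    [ContMDiffVectorBundle ∞ FA A I]
    (hP : ∀ m (b : B m), (∀ x : A m, P.toFun m x b = 0) → b = 0) : P.SeparatesRight := by
  intro ξ h
  ext m
  refine hP m _ fun x => ?_
  obtain ⟨Y, rfl⟩ := exists_section_eq I FA A m x
  exact congrArg (fun s : Cₛ^∞⟮I; FE, E⟯ => s m) (h Y)

end BundlePairing

theorem LieAlgebroid.bracket_swap (L : LieAlgebroid I FA A) (X Y : Cₛ^∞⟮I; FA, A⟯) :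
    L.bracket X Y = -L.bracket Y X := by
  have h := L.bracket_self (X + Y)
  simp only [map_add, LinearMap.add_apply, L.bracket_self, zero_add, add_zero] at h
  exact eq_neg_of_add_eq_zero_right h

namespace InvariantRep

variable {P : BundlePairing I FE E FA A FB B} (S : InvariantRep P)

/-- `d` and `lieDer` are chosen witnesses, so their linearity rests on uniqueness, which separation
supplies. -/
theorem d_add (hP : P.SeparatesRight) (u v : Cₛ^∞⟮I; FE, E⟯) :
    S.d (u + v) = S.d u + S.d v :=
  hP.ext fun Z => by simp [S.sec_d]

theorem d_smul (hP : P.SeparatesRight) (c : ℝ) (u : Cₛ^∞⟮I; FE, E⟯) :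
    S.d (c • u) = c • S.d u :=
  hP.ext fun Z => by simp [S.sec_d]

theorem d_zero (hP : P.SeparatesRight)  :
    S.d 0 = 0 :=
  hP.ext fun Z => by simp [S.sec_d]

theorem lieDer_add_left (hP : P.SeparatesRight) (X Y : Cₛ^∞⟮I; FA, A⟯) (ξ : Cₛ^∞⟮I; FB, B⟯) :
    S.lieDer (X + Y) ξ = S.lieDer X ξ + S.lieDer Y ξ :=
  hP.ext fun Z => by simp [S.sec_lieDer]; abel

theorem lieDer_add_right (hP : P.SeparatesRight) (X : Cₛ^∞⟮I; FA, A⟯) (ξ η : Cₛ^∞⟮I; FB, B⟯) :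
    S.lieDer X (ξ + η) = S.lieDer X ξ + S.lieDer X η :=
  hP.ext fun Z => by simp [S.sec_lieDer]; abel

theorem lieDer_smul_left (hP : P.SeparatesRight) (c : ℝ) (X : Cₛ^∞⟮I; FA, A⟯) (ξ : Cₛ^∞⟮I; FB, B⟯) :
    S.lieDer (c • X) ξ = c • S.lieDer X ξ :=
  hP.ext fun Z => by simp [S.sec_lieDer, smul_sub]

theorem lieDer_smul_right (hP : P.SeparatesRight) (c : ℝ) (X : Cₛ^∞⟮I; FA, A⟯) (ξ : Cₛ^∞⟮I; FB, B⟯) :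
    S.lieDer X (c • ξ) = c • S.lieDer X ξ :=
  hP.ext fun Z => by simp [S.sec_lieDer, smul_sub]

theorem lieDer_zero_left (hP : P.SeparatesRight) (ξ : Cₛ^∞⟮I; FB, B⟯) :
    S.lieDer 0 ξ = 0 :=
  hP.ext fun Z => by simp [S.sec_lieDer]

theorem lieDer_zero_right (hP : P.SeparatesRight) (X : Cₛ^∞⟮I; FA, A⟯) :
    S.lieDer X 0 = 0 :=
  hP.ext fun Z => by simp [S.sec_lieDer]

/-- This expresses flatness: the representation sends brackets to commutators. -/
theorem lieDer_d (hP : P.SeparatesRight) (X : Cₛ^∞⟮I; FA, A⟯) (u : Cₛ^∞⟮I; FE, E⟯) :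
    S.lieDer X (S.d u) = S.d (S.rep.act X u) :=
  hP.ext fun Y => by
    rw [S.sec_lieDer, S.sec_d, S.sec_d, S.sec_d, S.rep.map_bracket]
    abel

end InvariantRep

end Sections

/-! ### The double A ⊕ B: identities valid for every E-dual pair -/

noncomputable section Double

variable {EM : Type*} [NormedAddCommGroup EM] [NormedSpace ℝ EM]
  {H : Type*} [TopologicalSpace H] {I : ModelWithCorners ℝ EM H}
  {M : Type*} [TopologicalSpace M] [ChartedSpace H M] [IsManifold I ∞ M]
  {FE : Type*} [NormedAddCommGroup FE] [NormedSpace ℝ FE]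
  {E : M → Type*} [TopologicalSpace (TotalSpace FE E)]
  [∀ m, AddCommGroup (E m)] [∀ m, Module ℝ (E m)] [∀ m, TopologicalSpace (E m)]
  [FiberBundle FE E] [VectorBundle ℝ FE E]
  {FA : Type*} [NormedAddCommGroup FA] [NormedSpace ℝ FA]
  {A : M → Type*} [TopologicalSpace (TotalSpace FA A)]
  [∀ m, AddCommGroup (A m)] [∀ m, Module ℝ (A m)] [∀ m, TopologicalSpace (A m)]
  [FiberBundle FA A] [VectorBundle ℝ FA A]
  {FB : Type*} [NormedAddCommGroup FB] [NormedSpace ℝ FB]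
  {B : M → Type*} [TopologicalSpace (TotalSpace FB B)]
  [∀ m, AddCommGroup (B m)] [∀ m, Module ℝ (B m)] [∀ m, TopologicalSpace (B m)]
  [FiberBundle FB B] [VectorBundle ℝ FB B]

section ProdSec

variable (X Y : Cₛ^∞⟮I; FA, A⟯) (ξ η : Cₛ^∞⟮I; FB, B⟯)
  (e e' : Cₛ^∞⟮I; FA × FB, A ×ᵇ B⟯)

@[simp] theorem fstSec_prodSec : fstSec (prodSec X ξ) = X := rfl
@[simp] theorem sndSec_prodSec : sndSec (prodSec X ξ) = ξ := rfl
@[simp] theorem prodSec_fstSec_sndSec : prodSec (fstSec e) (sndSec e) = e := rfl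
@[simp] theorem fstSec_add : fstSec (e + e') = fstSec e + fstSec e' := rfl
@[simp] theorem sndSec_add : sndSec (e + e') = sndSec e + sndSec e' := rfl
@[simp] theorem fstSec_sub : fstSec (e - e') = fstSec e - fstSec e' := rfl
@[simp] theorem sndSec_sub : sndSec (e - e') = sndSec e - sndSec e' := rfl
@[simp] theorem fstSec_smul (c : ℝ) : fstSec (c • e) = c • fstSec e := rfl
@[simp] theorem sndSec_smul (c : ℝ) : sndSec (c • e) = c • sndSec e := rfl
@[simp] theorem fstSec_zero : fstSec (0 : Cₛ^∞⟮I; FA × FB, A ×ᵇ B⟯) = 0 := rfl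
@[simp] theorem sndSec_zero : sndSec (0 : Cₛ^∞⟮I; FA × FB, A ×ᵇ B⟯) = 0 := rfl

variable {e e'} in
theorem prod_section_ext (h1 : fstSec e = fstSec e') (h2 : sndSec e = sndSec e') : e = e' := by
  rw [← prodSec_fstSec_sndSec e, h1, h2, prodSec_fstSec_sndSec]

end ProdSec

namespace EDualPair

variable (D : EDualPair I FE E FA A FB B)

theorem doublePairing_sec (e e' : Cₛ^∞⟮I; FA × FB, A ×ᵇ B⟯) :
    D.doublePairing.sec e e' = (1 / 2 : ℝ) • (D.pairing.sec (fstSec e) (sndSec e') +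
      D.pairing.sec (fstSec e') (sndSec e)) := rfl

theorem doubleAnchor_act (e : Cₛ^∞⟮I; FA × FB, A ×ᵇ B⟯) (u : Cₛ^∞⟮I; FE, E⟯) :
    D.doubleAnchor.act e u = D.left.rep.act (fstSec e) u + D.right.rep.act (sndSec e) u := rfl

/-- The section `d^B u + d^A u` of `A ⊕ B`. -/
def doubleD (u : Cₛ^∞⟮I; FE, E⟯) : Cₛ^∞⟮I; FA × FB, A ×ᵇ B⟯ := prodSec (D.right.d u) (D.left.d u)

theorem sec_right_d (u : Cₛ^∞⟮I; FE, E⟯) (ξ : Cₛ^∞⟮I; FB, B⟯) :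
    D.pairing.sec (D.right.d u) ξ = D.right.rep.act ξ u := D.right.sec_d u ξ

theorem sec_right_lieDer (ξ η : Cₛ^∞⟮I; FB, B⟯) (X : Cₛ^∞⟮I; FA, A⟯) :
    D.pairing.sec (D.right.lieDer ξ X) η =
      D.right.rep.act ξ (D.pairing.sec X η) - D.pairing.sec X (D.right.lie.bracket ξ η) :=
  D.right.sec_lieDer ξ X η

theorem doublePairing_doubleD (u : Cₛ^∞⟮I; FE, E⟯) (e : Cₛ^∞⟮I; FA × FB, A ×ᵇ B⟯) :
    (2 : ℝ) • D.doublePairing.sec e (D.doubleD u) = D.doubleAnchor.act e u := by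
  simp only [doublePairing_sec, doubleAnchor_act, doubleD, fstSec_prodSec, sndSec_prodSec,
    D.left.sec_d, D.sec_right_d]
  module

/-- The Lie brackets vanish and the Lie derivatives cancel, so only the two differentials of ⟨X,
ξ⟩_E survive. -/
theorem doubleBracket_self (e : Cₛ^∞⟮I; FA × FB, A ×ᵇ B⟯) :
    D.doubleBracket e e = D.doubleD (D.doublePairing.sec e e) := by
  have h : D.doublePairing.sec e e = D.pairing.sec (fstSec e) (sndSec e) := by
    rw [doublePairing_sec]
    module
  rw [h]
  apply prod_section_ext <;>
    simp [doubleBracket, doubleD, LieAlgebroid.bracket_self]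

/-- No bialgebroid condition enters: unfolding d and 𝔏 inside the pairing leaves bracket terms that
cancel by skew-symmetry of the two Lie brackets. -/
theorem doubleAnchor_invariance (e₁ e₂ e₃ : Cₛ^∞⟮I; FA × FB, A ×ᵇ B⟯) :
    D.doubleAnchor.act e₁ (D.doublePairing.sec e₂ e₃) =
      D.doublePairing.sec (D.doubleBracket e₁ e₂) e₃ +
        D.doublePairing.sec e₂ (D.doubleBracket e₁ e₃) := by
  simp only [doublePairing_sec, doubleAnchor_act, doubleBracket, fstSec_prodSec, sndSec_prodSec,
    GaugeMap.act_add_right, GaugeMap.act_smul_right, BundlePairing.sec_add_left,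
    BundlePairing.sec_add_right, BundlePairing.sec_sub_left, BundlePairing.sec_sub_right,
    D.left.sec_d, D.sec_right_d, D.left.sec_lieDer, D.sec_right_lieDer]
  rw [D.left.lie.bracket_swap (fstSec e₃) (fstSec e₂),
    D.right.lie.bracket_swap (sndSec e₃) (sndSec e₂)]
  simp only [BundlePairing.sec_neg_left, BundlePairing.sec_neg_right]
  module

/-! ### Consequences of conditions (2) and (3) -/

variable {D}

/-- Both sides are ⟨d^B v, d^A u⟩_E. -/
theorem left_act_right_d (u v : Cₛ^∞⟮I; FE, E⟯) :
    D.left.rep.act (D.right.d v) u = D.right.rep.act (D.left.d u) v := by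
  rw [← D.left.sec_d, D.sec_right_d]

/-- Polarization of condition (3). It says that the anchor of the double kills every 𝒟u. -/
theorem IsELieBialgebroid.right_act_left_d (hD : D.IsELieBialgebroid)
    (hl : D.pairing.SeparatesRight) (hr : D.pairing.flip.SeparatesRight)
    (u v : Cₛ^∞⟮I; FE, E⟯) :
    D.right.rep.act (D.left.d u) v = -D.left.rep.act (D.right.d u) v := by
  have h := hD.pairing_d (u + v)
  rw [D.right.d_add hr, D.left.d_add hl] at h
  simp only [BundlePairing.sec_add_left, BundlePairing.sec_add_right, hD.pairing_d, zero_add,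
    add_zero] at h
  rw [D.left.sec_d, D.left.sec_d, left_act_right_d u v] at h
  exact eq_neg_of_add_eq_zero_left h

theorem IsELieBialgebroid.sec_bracket_left_d (hD : D.IsELieBialgebroid)
    (u : Cₛ^∞⟮I; FE, E⟯) (X : Cₛ^∞⟮I; FA, A⟯) (ξ : Cₛ^∞⟮I; FB, B⟯) :
    D.pairing.sec X (D.right.lie.bracket (D.left.d u) ξ) =
      D.right.rep.act (D.left.d u) (D.pairing.sec X ξ) +
        D.pairing.sec (D.left.lie.bracket (D.right.d u) X) ξ := by
  have h := D.sec_right_lieDer (D.left.d u) ξ X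
  rw [hD.lieDer_d, BundlePairing.sec_neg_left] at h
  linear_combination (norm := module) h

/-- Condition (2) with A and B exchanged. The definition assumes only one side; the other follows by
duality, with (3) fixing the sign of the anchor term. -/
theorem IsELieBialgebroid.left_lieDer_right_d (hD : D.IsELieBialgebroid)
    (hl : D.pairing.SeparatesRight) (hr : D.pairing.flip.SeparatesRight)
    (u : Cₛ^∞⟮I; FE, E⟯) (ξ : Cₛ^∞⟮I; FB, B⟯) :
    D.left.lieDer (D.right.d u) ξ = -D.right.lie.bracket (D.left.d u) ξ :=
  hl.ext fun Y => by
    rw [D.left.sec_lieDer, BundlePairing.sec_neg_right, hD.sec_bracket_left_d,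
      hD.right_act_left_d hl hr]
    abel

/-- Writing ρ_A(𝔏_ξ X)u = ⟨𝔏_ξ X, d^A u⟩_E and ρ_B(𝔏_X ξ)u = ⟨d^B u, 𝔏_X ξ⟩_E produces both
second-order terms. Condition (2), in dual form, cancels the remaining brackets up to ρ_B(d^A u)⟨X,
ξ⟩_E. -/
theorem IsELieBialgebroid.commutator_act (hD : D.IsELieBialgebroid)
    (X : Cₛ^∞⟮I; FA, A⟯) (ξ : Cₛ^∞⟮I; FB, B⟯) (u : Cₛ^∞⟮I; FE, E⟯) :
    D.left.rep.act X (D.right.rep.act ξ u) - D.right.rep.act ξ (D.left.rep.act X u) =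
      D.left.rep.act (D.right.d (D.pairing.sec X ξ)) u -
        D.left.rep.act (D.right.lieDer ξ X) u + D.right.rep.act (D.left.lieDer X ξ) u := by
  rw [← D.left.sec_d u (D.right.lieDer ξ X), ← D.sec_right_d u (D.left.lieDer X ξ),
    D.sec_right_lieDer, D.left.sec_lieDer, D.left.sec_d, D.sec_right_d,
    D.right.lie.bracket_swap, BundlePairing.sec_neg_right, hD.sec_bracket_left_d,
    left_act_right_d, D.left.lie.bracket_swap X, BundlePairing.sec_neg_left]
  abel

theorem IsELieBialgebroid.doubleAnchor_bracket (hD : D.IsELieBialgebroid)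
    (hl : D.pairing.SeparatesRight) (hr : D.pairing.flip.SeparatesRight)
    (e₁ e₂ : Cₛ^∞⟮I; FA × FB, A ×ᵇ B⟯) (u : Cₛ^∞⟮I; FE, E⟯) :
    D.doubleAnchor.act (D.doubleBracket e₁ e₂) u =
      D.doubleAnchor.act e₁ (D.doubleAnchor.act e₂ u) -
        D.doubleAnchor.act e₂ (D.doubleAnchor.act e₁ u) := by
  have h1 := hD.commutator_act (fstSec e₁) (sndSec e₂) u
  have h2 := hD.commutator_act (fstSec e₂) (sndSec e₁) u
  simp only [doubleAnchor_act, doubleBracket, fstSec_prodSec, sndSec_prodSec,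
    GaugeMap.act_add_right, GaugeMap.act_add_left, GaugeMap.act_sub_left,
    D.left.rep.map_bracket, D.right.rep.map_bracket, hD.right_act_left_d hl hr]
  -- The two mixed commutators enter with opposite signs; (3) has already replaced ρ_B ∘ d^A by -ρ_A
  -- ∘ d^B, which matches the asymmetric differentials in the bracket.
  linear_combination (norm := module) h2 - h1

/-- In each component, (2) or its mirror image cancels one pair of terms, and 𝔏 ∘ d = d ∘ ρ cancels
the other. -/
theorem IsELieBialgebroid.doubleBracket_doubleD (hD : D.IsELieBialgebroid)
    (hl : D.pairing.SeparatesRight) (hr : D.pairing.flip.SeparatesRight)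
    (u : Cₛ^∞⟮I; FE, E⟯) (e : Cₛ^∞⟮I; FA × FB, A ×ᵇ B⟯) :
    D.doubleBracket (D.doubleD u) e = 0 := by
  apply prod_section_ext
  · simp only [doubleBracket, doubleD, fstSec_prodSec, sndSec_prodSec, hD.lieDer_d,
      D.right.lieDer_d hr, D.sec_right_d, fstSec_zero]
    abel
  · simp only [doubleBracket, doubleD, fstSec_prodSec, sndSec_prodSec,
      hD.left_lieDer_right_d hl hr, D.left.lieDer_d hl, D.left.sec_d, sndSec_zero]
    abel

/-! ### Bilinearity and the Leibniz identity of the double -/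

variable (D) in
/-- The bracket of the double, as a bilinear map. -/
def doubleBracketₗ (hl : D.pairing.SeparatesRight) (hr : D.pairing.flip.SeparatesRight) :
    Cₛ^∞⟮I; FA × FB, A ×ᵇ B⟯ →ₗ[ℝ] Cₛ^∞⟮I; FA × FB, A ×ᵇ B⟯ →ₗ[ℝ]
      Cₛ^∞⟮I; FA × FB, A ×ᵇ B⟯ :=
  LinearMap.mk₂ ℝ D.doubleBracket
    (fun e₁ e₂ e => by
      apply prod_section_ext <;>
      · simp only [doubleBracket, fstSec_prodSec, sndSec_prodSec, fstSec_add, sndSec_add, map_add,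
          LinearMap.add_apply, BundlePairing.sec_add_left, BundlePairing.sec_add_right,
          D.left.lieDer_add_left hl, D.left.lieDer_add_right hl, D.right.lieDer_add_left hr,
          D.right.lieDer_add_right hr, D.left.d_add hl, D.right.d_add hr]
        abel)
    (fun c e₁ e => by
      apply prod_section_ext <;>
      · simp only [doubleBracket, fstSec_prodSec, sndSec_prodSec, fstSec_smul, sndSec_smul,
          map_smul, LinearMap.smul_apply, BundlePairing.sec_smul_left,
          BundlePairing.sec_smul_right, D.left.lieDer_smul_left hl, D.left.lieDer_smul_right hl,
          D.right.lieDer_smul_left hr, D.right.lieDer_smul_right hr, D.left.d_smul hl,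
          D.right.d_smul hr]
        module)
    (fun e e₁ e₂ => by
      apply prod_section_ext <;>
      · simp only [doubleBracket, fstSec_prodSec, sndSec_prodSec, fstSec_add, sndSec_add, map_add,
          BundlePairing.sec_add_left, BundlePairing.sec_add_right,
          D.left.lieDer_add_left hl, D.left.lieDer_add_right hl, D.right.lieDer_add_left hr,
          D.right.lieDer_add_right hr, D.left.d_add hl, D.right.d_add hr]
        abel)
    (fun c e e₁ => by
      apply prod_section_ext <;>
      · simp only [doubleBracket, fstSec_prodSec, sndSec_prodSec, fstSec_smul, sndSec_smul,
          map_smul, BundlePairing.sec_smul_left,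
          BundlePairing.sec_smul_right, D.left.lieDer_smul_left hl, D.left.lieDer_smul_right hl,
          D.right.lieDer_smul_left hr, D.right.lieDer_smul_right hr, D.left.d_smul hl,
          D.right.d_smul hr]
        module)

variable (D) in
/-- `u ↦ d^B u + d^A u` as a linear map. -/
def doubleDₗ (hl : D.pairing.SeparatesRight) (hr : D.pairing.flip.SeparatesRight) :
    Cₛ^∞⟮I; FE, E⟯ →ₗ[ℝ] Cₛ^∞⟮I; FA × FB, A ×ᵇ B⟯ where
  toFun := D.doubleD
  map_add' u v := prod_section_ext (D.right.d_add hr u v) (D.left.d_add hl u v)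
  map_smul' c u := prod_section_ext (D.right.d_smul hr c u) (D.left.d_smul hl c u)

/-- Cartan's formula ι_ξ d^B Y = 𝔏_ξ Y - d^B⟨Y, ξ⟩_E. This is the combination that occurs in the
bracket of the double. -/
theorem right_dDual_apply (Y : Cₛ^∞⟮I; FA, A⟯) (ξ η : Cₛ^∞⟮I; FB, B⟯) :
    D.right.dDual Y ![ξ, η] =
      D.pairing.sec (D.right.lieDer ξ Y - D.right.d (D.pairing.sec Y ξ)) η := by
  rw [D.right.dDual_apply, BundlePairing.sec_sub_left, D.sec_right_lieDer, D.sec_right_d]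
  simp only [BundlePairing.flip_sec]
  abel

theorem lieDerForm_pair (S : InvariantRep D.pairing) (X : Cₛ^∞⟮I; FA, A⟯)
    (Ξ : (Fin 2 → Cₛ^∞⟮I; FB, B⟯) → Cₛ^∞⟮I; FE, E⟯) (ξ η : Cₛ^∞⟮I; FB, B⟯) :
    S.lieDerForm X Ξ ![ξ, η] = S.rep.act X (Ξ ![ξ, η]) -
      (Ξ ![S.lieDer X ξ, η] + Ξ ![ξ, S.lieDer X η]) := by
  have h0 : ∀ ζ, Function.update ![ξ, η] 0 ζ = ![ζ, η] := fun ζ => by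
    ext i : 1
    fin_cases i <;> rfl
  have h1 : ∀ ζ, Function.update ![ξ, η] 1 ζ = ![ξ, ζ] := fun ζ => by
    ext i : 1
    fin_cases i <;> rfl
  rw [InvariantRep.lieDerForm, Fin.sum_univ_two, h0, h1]
  rfl

theorem IsELieBialgebroid.sec_jacobiator (hD : D.IsELieBialgebroid)
    (hl : D.pairing.SeparatesRight) (hr : D.pairing.flip.SeparatesRight)
    (X Y : Cₛ^∞⟮I; FA, A⟯) (ξ η : Cₛ^∞⟮I; FB, B⟯) :
    D.doublePairing.sec (jacobiator (D.doubleBracketₗ hl hr) (prodSec X 0) (prodSec Y 0)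
      (prodSec 0 ξ)) (prodSec 0 η) = 0 := by
  -- For e = W + ζ this reads [X, e] = ([X, W] - ι_ζ d^B X) + 𝔏_X ζ, so nested brackets involve d^B
  -- only through contractions.
  have mixed : ∀ (X : Cₛ^∞⟮I; FA, A⟯) (e : Cₛ^∞⟮I; FA × FB, A ×ᵇ B⟯),
      D.doubleBracket (prodSec X 0) e =
        prodSec (D.left.lie.bracket X (fstSec e) -
          (D.right.lieDer (sndSec e) X - D.right.d (D.pairing.sec X (sndSec e))))
          (D.left.lieDer X (sndSec e)) := by
    intro X e
    apply prod_section_ext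
    · simp [doubleBracket, D.right.lieDer_zero_left hr, sub_add]
    · simp [doubleBracket, D.left.lieDer_zero_right hl, D.left.d_zero hl]
  have hbr : ∀ X W : Cₛ^∞⟮I; FA, A⟯, D.pairing.sec (D.left.lie.bracket X W) η =
      D.left.rep.act X (D.pairing.sec W η) - D.pairing.sec W (D.left.lieDer X η) := by
    intro X W
    rw [D.left.sec_lieDer]
    abel
  have h0 : D.doubleBracket (prodSec X 0) (prodSec Y 0) = prodSec (D.left.lie.bracket X Y) 0 := by
    rw [mixed]
    apply prod_section_ext <;>
      simp [D.left.lieDer_zero_right hl, D.right.lieDer_zero_left hr, D.right.d_zero hr]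
  have h := congrFun (hD.d_bracket X Y) ![ξ, η]
  rw [Pi.sub_apply, lieDerForm_pair, lieDerForm_pair] at h
  simp only [right_dDual_apply] at h
  change D.doublePairing.sec (D.doubleBracket _ (D.doubleBracket _ _) -
    D.doubleBracket (D.doubleBracket _ _) _ - D.doubleBracket _ (D.doubleBracket _ _)) _ = 0
  rw [h0, mixed X, mixed X, mixed Y, mixed Y, mixed, doublePairing_sec]
  simp only [fstSec_sub, fstSec_prodSec, sndSec_prodSec, BundlePairing.sec_zero_left, map_zero,
    zero_sub, add_zero]
  simp only [map_neg, map_sub, BundlePairing.sec_sub_left, BundlePairing.sec_neg_left, hbr,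
    GaugeMap.act_sub_right] at h ⊢
  -- The factor ½ is the normalization of the pairing on the double.
  linear_combination (norm := module) (1 / 2 : ℝ) • h

theorem IsELieBialgebroid.leibniz (hD : D.IsELieBialgebroid)
    (hl : D.pairing.SeparatesRight) (hr : D.pairing.flip.SeparatesRight)
    (hsep : D.doublePairing.flip.SeparatesRight)
    (e₁ e₂ e₃ : Cₛ^∞⟮I; FA × FB, A ×ᵇ B⟯) :
    D.doubleBracket e₁ (D.doubleBracket e₂ e₃) =
      D.doubleBracket (D.doubleBracket e₁ e₂) e₃ +
        D.doubleBracket e₂ (D.doubleBracket e₁ e₃) := by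
  have key : jacobiator (D.doubleBracketₗ hl hr) e₁ e₂ e₃ = 0 := by
    have hsymm : ∀ e e', D.doublePairing.secₗ e e' = D.doublePairing.secₗ e' e := by
      intro e e'
      change D.doublePairing.sec e e' = D.doublePairing.sec e' e
      rw [doublePairing_sec, doublePairing_sec, add_comm]
    have hsep' : ∀ e, (∀ e', D.doublePairing.secₗ e e' = 0) → e = 0 := hsep
    have hself : ∀ e, D.doubleBracketₗ hl hr e e = D.doubleDₗ hl hr (D.doublePairing.secₗ e e) :=
      D.doubleBracket_self
    have hD0 : ∀ u e, D.doubleBracketₗ hl hr (D.doubleDₗ hl hr u) e = 0 :=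
      hD.doubleBracket_doubleD hl hr
    have hinv : ∀ e₁ e₂ e₃, D.doubleAnchor.actₗ e₁ (D.doublePairing.secₗ e₂ e₃) =
      D.doublePairing.secₗ (D.doubleBracketₗ hl hr e₁ e₂) e₃ +
        D.doublePairing.secₗ e₂ (D.doubleBracketₗ hl hr e₁ e₃) :=
      D.doubleAnchor_invariance
    have hpD : ∀ u e, (2 : ℝ) • D.doublePairing.secₗ e (D.doubleDₗ hl hr u) =
      D.doubleAnchor.actₗ e u := D.doublePairing_doubleD
    have hact : ∀ e₁ e₂ u, D.doubleAnchor.actₗ (D.doubleBracketₗ hl hr e₁ e₂) u =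
      D.doubleAnchor.actₗ e₁ (D.doubleAnchor.actₗ e₂ u) -
        D.doubleAnchor.actₗ e₂ (D.doubleAnchor.actₗ e₁ u) := hD.doubleAnchor_bracket hl hr
    refine jacobiator_eq_zero (fun X : Cₛ^∞⟮I; FA, A⟯ => prodSec X 0)
      (fun ξ : Cₛ^∞⟮I; FB, B⟯ => prodSec 0 ξ)
      (fun e => ⟨fstSec e, sndSec e, by apply prod_section_ext <;> simp⟩)
      hsep' hsymm hself hD0 hinv hpD hact ?_ ?_ (hD.sec_jacobiator hl hr) e₁ e₂ e₃
    · have h0 : ∀ X Y, D.doubleBracketₗ hl hr (prodSec X 0) (prodSec Y 0) =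
          prodSec (D.left.lie.bracket X Y) 0 := by
        intro X Y
        apply prod_section_ext <;>
          simp [doubleBracketₗ, doubleBracket, D.left.lieDer_zero_right hl,
            D.right.lieDer_zero_left hr, D.right.d_zero hr, D.left.d_zero hl]
      intro X Y Z
      rw [jacobiator, h0, h0, h0, h0, h0, h0, D.left.lie.jacobi X Y Z]
      apply prod_section_ext <;> simp
    · have h0 : ∀ ξ η, D.doubleBracketₗ hl hr (prodSec 0 ξ) (prodSec 0 η) =
          prodSec 0 (D.right.lie.bracket ξ η) := by
        intro ξ η
        apply prod_section_ext <;>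
          simp [doubleBracketₗ, doubleBracket, D.left.lieDer_zero_left hl,
            D.right.lieDer_zero_right hr, D.right.d_zero hr, D.left.d_zero hl]
      intro ξ η ζ
      rw [jacobiator, h0, h0, h0, h0, h0, h0, D.right.lie.jacobi ξ η ζ]
      apply prod_section_ext <;> simp
  rw [jacobiator, sub_sub, sub_eq_zero] at key
  exact key

theorem doublePairing_symm (m : M) (x y : A m × B m) :
    D.doublePairing.toFun m x y = D.doublePairing.toFun m y x := by
  change (1 / 2 : ℝ) • (D.pairing.toFun m x.1 y.2 + D.pairing.toFun m y.1 x.2) =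
    (1 / 2 : ℝ) • (D.pairing.toFun m y.1 x.2 + D.pairing.toFun m x.1 y.2)
  rw [add_comm]

variable (D) in
theorem doublePairing_nondegenerate : D.doublePairing.Nondegenerate := by
  have h : ∀ m (x : A m × B m), (∀ y : A m × B m, D.doublePairing.toFun m x y = 0) → x = 0 := by
    intro m x hx
    have hx' : ∀ y : A m × B m,
        (1 / 2 : ℝ) • (D.pairing.toFun m x.1 y.2 + D.pairing.toFun m y.1 x.2) = 0 := hx
    refine Prod.ext (D.nondegenerate.1 m _ fun b => ?_) (D.nondegenerate.2 m _ fun a => ?_)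
    · simpa using hx' (0, b)
    · simpa using hx' (a, 0)
  exact ⟨h, fun m x hx => h m x fun y => (doublePairing_symm m x y).trans (hx y)⟩

end EDualPair

end Double

end ECourant

/-! ### The double is an E-Courant algebroid -/

theorem mainTheorem7
    {EM : Type*} [NormedAddCommGroup EM] [NormedSpace ℝ EM] [FiniteDimensional ℝ EM]
    {H : Type*} [TopologicalSpace H] (I : ModelWithCorners ℝ EM H)
    {M : Type*} [TopologicalSpace M] [ChartedSpace H M] [IsManifold I ∞ M]
    [BoundarylessManifold I M] [T2Space M] [SigmaCompactSpace M]
    (FE : Type*) [NormedAddCommGroup FE] [NormedSpace ℝ FE] [FiniteDimensional ℝ FE]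
    (E : M → Type*) [TopologicalSpace (TotalSpace FE E)]
    [∀ m, AddCommGroup (E m)] [∀ m, Module ℝ (E m)] [∀ m, TopologicalSpace (E m)]
    [FiberBundle FE E] [VectorBundle ℝ FE E] [ContMDiffVectorBundle ∞ FE E I]
    (FA : Type*) [NormedAddCommGroup FA] [NormedSpace ℝ FA] [FiniteDimensional ℝ FA]
    (A : M → Type*) [TopologicalSpace (TotalSpace FA A)]
    [∀ m, AddCommGroup (A m)] [∀ m, Module ℝ (A m)] [∀ m, TopologicalSpace (A m)]
    [FiberBundle FA A] [VectorBundle ℝ FA A] [ContMDiffVectorBundle ∞ FA A I]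
    (FB : Type*) [NormedAddCommGroup FB] [NormedSpace ℝ FB] [FiniteDimensional ℝ FB]
    (B : M → Type*) [TopologicalSpace (TotalSpace FB B)]
    [∀ m, AddCommGroup (B m)] [∀ m, Module ℝ (B m)] [∀ m, TopologicalSpace (B m)]
    [FiberBundle FB B] [VectorBundle ℝ FB B] [ContMDiffVectorBundle ∞ FB B I]
    (D : ECourant.EDualPair I FE E FA A FB B) (hD : D.IsELieBialgebroid) :
    ECourant.IsECourantAlgebroid D.doublePairing D.doubleBracket D.doubleAnchor := by
  obtain ⟨hn1, hn2⟩ := D.nondegenerate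
  have hl : D.pairing.SeparatesRight :=
    ECourant.BundlePairing.separatesRight_of_nondegenerate hn2
  have hr : D.pairing.flip.SeparatesRight :=
    ECourant.BundlePairing.separatesRight_of_nondegenerate hn1
  have hsep : D.doublePairing.flip.SeparatesRight := fun e h => by
    have h' : ∀ e', D.doublePairing.sec e e' = 0 := h
    simp only [D.doublePairing_sec] at h'
    apply ECourant.prod_section_ext
    · exact hr _ fun ξ => by
        simpa [ECourant.BundlePairing.flip_sec] using h' (ECourant.prodSec 0 ξ)
    · exact hl _ fun X => by
        simpa using h' (ECourant.prodSec X 0)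
  have extend : ∀ (m : M) (x : A m × B m),
      ∃ (X : Cₛ^∞⟮I; FA, A⟯) (ξ : Cₛ^∞⟮I; FB, B⟯), x = ECourant.prodSec X ξ m := by
    intro m x
    obtain ⟨X, hX⟩ := ECourant.exists_section_eq I FA A m x.1
    obtain ⟨ξ, hξ⟩ := ECourant.exists_section_eq I FB B m x.2
    exact ⟨X, ξ, Prod.ext hX.symm hξ.symm⟩
  -- 𝒟u(m) represents ρ^⋆[u]_m: the identity on sections passes to the fibre by extending the test
  -- vector.
  have star_jet : ∀ (m : M) (u : Cₛ^∞⟮I; FE, E⟯),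
      ECourant.pairingEmb D.doublePairing m (D.doubleD u m) =
        D.doubleAnchor.star m (ECourant.jet I FE E m u) := by
    intro m u
    refine LinearMap.ext fun x => ?_
    obtain ⟨X, ξ, rfl⟩ := extend m x
    have h := congrArg (fun s : Cₛ^∞⟮I; FE, E⟯ => s m)
      (D.doublePairing_doubleD u (ECourant.prodSec X ξ))
    refine Eq.trans ?_ h
    change (2 : ℝ) • D.doublePairing.toFun m (D.doubleD u m) (ECourant.prodSec X ξ m) =
      (2 : ℝ) • D.doublePairing.toFun m (ECourant.prodSec X ξ m) (D.doubleD u m)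
    rw [ECourant.EDualPair.doublePairing_symm]
  refine
    { add_br := (D.doubleBracketₗ hl hr).map_add₂
      smul_br := (D.doubleBracketₗ hl hr).map_smul₂
      br_add := fun e => (D.doubleBracketₗ hl hr e).map_add
      br_smul := fun c e => (D.doubleBracketₗ hl hr e).map_smul c
      leibniz := hD.leibniz hl hr hsep
      symm := ECourant.EDualPair.doublePairing_symm
      nondegenerate := D.doublePairing_nondegenerate
      anchor_br := hD.doubleAnchor_bracket hl hr
      br_self := fun e m => by rw [D.doubleBracket_self, star_jet]
      invariance := D.doubleAnchor_invariance
      star_mem := ?_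
      anchor_star := ?_ }
  · rintro m _ ⟨u, rfl⟩
    exact ⟨D.doubleD u m, star_jet m u⟩
  · rintro m _ ⟨u, rfl⟩ κ hκ
    -- Nondegeneracy makes the representative of ρ^⋆[u]_m unique, so it remains to use ρ(𝒟u) = 0.
    have hκ' : κ = D.doubleD u m := by
      refine sub_eq_zero.1 (D.doublePairing_nondegenerate.1 m _ fun y => ?_)
      have h := LinearMap.congr_fun (hκ.trans (star_jet m u).symm) y
      have h2 : (2 : ℝ) • D.doublePairing.toFun m κ y =
        (2 : ℝ) • D.doublePairing.toFun m (D.doubleD u m) y := h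
      rw [map_sub, LinearMap.sub_apply, smul_right_injective _ two_ne_zero h2, sub_self]
    subst hκ'
    refine Subtype.ext (LinearMap.ext fun v => ?_)
    have h : D.left.rep.act (D.right.d u) v + D.right.rep.act (D.left.d u) v = 0 := by
      rw [hD.right_act_left_d hl hr, add_neg_cancel]
    exact congrArg (fun s : Cₛ^∞⟮I; FE, E⟯ => s m) h
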